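/- Theorem 3.1. Let $(N,h)$ be a connected, oriented, real-analytic Riemannian manifold of dimension three, let $u$ be a smooth positive function and $A$ a smooth one-form on $N$ satisfying the monopole equation $\mathrm{d}u=*\,\mathrm{d}A$, where $*$ is the Hodge star operator of $(N,h)$, and let $(M,g)$ be given by the Gibbons–Hawking construction from these data, that is, $M=N\times\mathbb{R}$ and $$g=u\,h+u^{-1}(\mathrm{d}t+A)^2,$$ where $t$ is the coordinate on $\mathbb{R}$, and $h$, $u$, $A$ are pulled back by the projection $\varphi:M=N\times\mathbb{R}\to N$. A vector field $E$ on $M$ is called a soliton flow on $(M,g)$ if there is a constant $a\in\mathbb{R}$ such that $$\mathrm{Ric}_g+a\,g+\tfrac12\,\mathcal{L}_E\,g=0 .$$ Then any real-analytic soliton flow on $(M,g)$ is uniquely determined by its restriction to any local section of $\varphi$: if $E$ and $E'$ are real-analytic soliton flows on $(M,g)$ (possibly with different constants $a$), $U\subseteq N$ is a nonempty open set, $\sigma:U\to M$ is a smooth map with $\varphi\circ\sigma=\mathrm{id}_U$, and $E_{\sigma(p)}=E'_{\sigma(p)}$ for all $p\in U$, then $E=E'$ on $M$. -/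

import Mathlib

open scoped Manifold ContDiff Topology

noncomputable section

/-! ### Tensor calculus on an open subset of a finite-dimensional vector space

A covariant 2-tensor field is a function `G : E → E → E → ℝ`, where `G x v w` is the value at the
point `x` on the vectors `v` and `w`; a vector field is a function `X : E → E`. -/

namespace CoordCalc

variable {E : Type*} [NormedAddCommGroup E] [NormedSpace ℝ E]

/-- The Lie derivative `(ℒ_X G)(v, w) = (D_X G)(v, w) + G(D_v X, w) + G(v, D_w X)` of a covariant
2-tensor field `G` along a vector field `X` (in coordinates,
`X^k ∂_k G_ij + G_kj ∂_i X^k + G_ik ∂_j X^k`). -/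
def lieDeriv (X : E → E) (G : E → E → E → ℝ) (x v w : E) : ℝ :=
  fderiv ℝ (fun y => G y v w) x (X x) + G x (fderiv ℝ X x v) w + G x v (fderiv ℝ X x w)

/-- The exterior derivative `(dα)(v, w) = (D_v α)(w) - (D_w α)(v)` of a 1-form `α`. -/
def extDerivOneForm (α : E → E → ℝ) (x v w : E) : ℝ :=
  fderiv ℝ (fun y => α y w) x v - fderiv ℝ (fun y => α y v) x w

variable [FiniteDimensional ℝ E]

/-- The index set of the linear coordinates used on `E`. -/
abbrev Idx (E : Type*) [NormedAddCommGroup E] [NormedSpace ℝ E] : Type :=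
  Fin (Module.finrank ℝ E)

/-- The coordinate vectors `∂_i`: a fixed basis of `E`. None of the tensors
below depends on its choice. -/
abbrev basisVec : Module.Basis (Idx E) ℝ E := Module.finBasis ℝ E

/-- The matrix `(G_ij)` of a covariant 2-tensor field. -/
def gram (G : E → E → E → ℝ) (x : E) : Matrix (Idx E) (Idx E) ℝ :=
  Matrix.of fun i j => G x (basisVec i) (basisVec j)

/-- The partial derivative `∂_i f` of a function. -/
def partialDeriv (i : Idx E) (f : E → ℝ) (x : E) : ℝ :=
  fderiv ℝ f x (basisVec i)

/-- The Christoffel symbols `Γ^k_ij = ½ ∑_l G^kl (∂_i G_jl + ∂_j G_il - ∂_l G_ij)` of the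
Levi-Civita connection of the metric `G`. -/
def christoffel (G : E → E → E → ℝ) (k i j : Idx E) (x : E) : ℝ :=
  (1 / 2) * ∑ l, ((gram G x)⁻¹) k l *
    (partialDeriv i (fun y => gram G y j l) x + partialDeriv j (fun y => gram G y i l) x
      - partialDeriv l (fun y => gram G y i j) x)

/-- The components
`R_ij = ∑_k (∂_k Γ^k_ij - ∂_j Γ^k_ik) + ∑_k ∑_l (Γ^k_kl Γ^l_ij - Γ^k_jl Γ^l_ik)`
of the Ricci tensor of the metric `G` (positive on round spheres). -/
def ricciComp (G : E → E → E → ℝ) (i j : Idx E) (x : E) : ℝ :=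
  ∑ k, (partialDeriv k (christoffel G k i j) x - partialDeriv j (christoffel G k i k) x)
    + ∑ k, ∑ l, (christoffel G k k l x * christoffel G l i j x
        - christoffel G k j l x * christoffel G l i k x)

/-- The Ricci tensor `Ric(v, w) = ∑_ij R_ij v^i w^j` of the metric `G`. -/
def ricci (G : E → E → E → ℝ) (x v w : E) : ℝ :=
  ∑ i, ∑ j, ricciComp G i j x * basisVec.repr v i * basisVec.repr w j

end CoordCalc

/-! ### Tensor fields on manifolds (without boundary), read in charts -/

section Charts

variable {E : Type*} [NormedAddCommGroup E] [NormedSpace ℝ E]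
  {H : Type*} [TopologicalSpace H] (I : ModelWithCorners ℝ E H)
  {M : Type*} [TopologicalSpace M] [ChartedSpace H M]

/-- The differential of the inverse of the preferred chart at `p`, at a point `x` of the image of
that chart. -/
def chartSymmDeriv (p : M) (x : E) :
    E →L[ℝ] TangentSpace I ((extChartAt I p).symm x) :=
  mfderivWithin 𝓘(ℝ, E) I (extChartAt I p).symm (Set.range I) x

/-- The expression of a covariant 2-tensor field in the preferred chart at `p`. -/
def tensorInChart (g : ∀ q : M, TangentSpace I q → TangentSpace I q → ℝ) (p : M) (x v w : E) : ℝ :=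
  g ((extChartAt I p).symm x) (chartSymmDeriv I p x v) (chartSymmDeriv I p x w)

/-- The expression of a 1-form in the preferred chart at `p`. -/
def oneFormInChart (α : ∀ q : M, TangentSpace I q →L[ℝ] ℝ) (p : M) (x v : E) : ℝ :=
  α ((extChartAt I p).symm x) (chartSymmDeriv I p x v)

/-- The expression of a vector field in the preferred chart at `p`. -/
def vectorFieldInChart (X : ∀ q : M, TangentSpace I q) (p : M) (x : E) : E :=
  VectorField.mpullbackWithin 𝓘(ℝ, E) I (extChartAt I p).symm X (Set.range I) x

/-- The exterior derivative of a 1-form, at the point `p`, computed in the preferred chart at `p`. -/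
def mextDerivOneForm (α : ∀ q : M, TangentSpace I q →L[ℝ] ℝ) (p : M) (v w : TangentSpace I p) : ℝ :=
  CoordCalc.extDerivOneForm (oneFormInChart I α p) (extChartAt I p p)
    (mvfderiv I (extChartAt I p) p v) (mvfderiv I (extChartAt I p) p w)

/-- The tensor equation `Ric + a g + ½ ℒ_X g = 0` on the Riemannian manifold `(M, g)`: it holds at
every point of every preferred chart. -/
def SolitonEquation [FiniteDimensional ℝ E]
    (g : ∀ q : M, TangentSpace I q → TangentSpace I q → ℝ)
    (X : ∀ q : M, TangentSpace I q) (a : ℝ) : Prop :=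
  ∀ p : M, ∀ x ∈ (extChartAt I p).target, ∀ v w : E,
    CoordCalc.ricci (tensorInChart I g p) x v w + a * tensorInChart I g p x v w
      + (1 / 2) * CoordCalc.lieDeriv (vectorFieldInChart I X p) (tensorInChart I g p) x v w = 0

/-- `X` is a soliton flow on `(M, g)`: `Ric + a g + ½ ℒ_X g = 0` for some constant `a`. -/
def IsSolitonFlow [FiniteDimensional ℝ E]
    (g : ∀ q : M, TangentSpace I q → TangentSpace I q → ℝ)
    (X : ∀ q : M, TangentSpace I q) : Prop :=
  ∃ a : ℝ, SolitonEquation I g X a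

end Charts

/-! ### The Gibbons–Hawking construction -/

section GibbonsHawking

/-- The model space `ℝ³`. -/
abbrev E3 : Type := EuclideanSpace ℝ (Fin 3)

variable {N : Type*} [TopologicalSpace N] [ChartedSpace E3 N] [IsManifold (𝓡 3) ω N]

/-- `o` is an orientation of the 3-manifold `N`: an orientation of each tangent space which is,
around every point, constant in the coordinates given by the chart at that point. -/
def IsOrientationField (o : ∀ p : N, Orientation ℝ (TangentSpace (𝓡 3) p) (Fin 3)) : Prop :=
  ∀ p : N, ∃ o₀ : Orientation ℝ E3 (Fin 3), ∀ᶠ q in 𝓝 p,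
    ∀ hq : q ∈ (trivializationAt E3 (TangentSpace (𝓡 3)) p).baseSet,
      Orientation.map (Fin 3)
        ((trivializationAt E3 (TangentSpace (𝓡 3)) p).continuousLinearEquivAt ℝ q hq).toLinearEquiv
        (o q) = o₀

/-- The monopole equation `du = *dA` on the oriented Riemannian 3-manifold `(N, h)`. The Hodge star
of a 2-form `β` is the 1-form such that `(*β)(e₂) = β(e₀, e₁)` for each positively oriented
orthonormal basis `(e₀, e₁, e₂)` of a tangent space. -/
def MonopoleEquation
    (h : Bundle.ContMDiffRiemannianMetric (𝓡 3) ω E3 (TangentSpace (𝓡 3) : N → Type _))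
    (o : ∀ p : N, Orientation ℝ (TangentSpace (𝓡 3) p) (Fin 3))
    (u : N → ℝ) (A : ∀ p : N, TangentSpace (𝓡 3) p →L[ℝ] ℝ) : Prop :=
  ∀ (p : N) (e : Module.Basis (Fin 3) ℝ (TangentSpace (𝓡 3) p)),
    (∀ i j, h.inner p (e i) (e j) = if i = j then 1 else 0) → e.orientation = o p →
      mvfderiv (𝓡 3) u p (e 2) = mextDerivOneForm (𝓡 3) A p (e 0) (e 1)

/-- The 1-form `θ = dt + A` on `N × ℝ`, where `t` is the projection to `ℝ` and `A` is pulled back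
by the projection to `N`. -/
def connectionForm (A : ∀ p : N, TangentSpace (𝓡 3) p →L[ℝ] ℝ) (q : N × ℝ)
    (v : TangentSpace ((𝓡 3).prod 𝓘(ℝ)) q) : ℝ :=
  mvfderiv ((𝓡 3).prod 𝓘(ℝ)) (Prod.snd : N × ℝ → ℝ) q v
    + A q.1 (mfderiv ((𝓡 3).prod 𝓘(ℝ)) (𝓡 3) (Prod.fst : N × ℝ → N) q v)

/-- The metric `g = u h + u⁻¹ (dt + A)²` on `N × ℝ`. -/
def gibbonsHawkingMetric
    (h : Bundle.ContMDiffRiemannianMetric (𝓡 3) ω E3 (TangentSpace (𝓡 3) : N → Type _))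
    (u : N → ℝ) (A : ∀ p : N, TangentSpace (𝓡 3) p →L[ℝ] ℝ) (q : N × ℝ)
    (v w : TangentSpace ((𝓡 3).prod 𝓘(ℝ)) q) : ℝ :=
  u q.1 * h.inner q.1
      (mfderiv ((𝓡 3).prod 𝓘(ℝ)) (𝓡 3) (Prod.fst : N × ℝ → N) q v)
      (mfderiv ((𝓡 3).prod 𝓘(ℝ)) (𝓡 3) (Prod.fst : N × ℝ → N) q w)
    + (u q.1)⁻¹ * (connectionForm A q v * connectionForm A q w)

/-- The data of the Gibbons–Hawking construction on the oriented Riemannian 3-manifold `(N, h)`: a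
smooth positive function `u` and a smooth 1-form `A` on `N` such that `du = *dA`. -/
structure IsGibbonsHawkingData
    (h : Bundle.ContMDiffRiemannianMetric (𝓡 3) ω E3 (TangentSpace (𝓡 3) : N → Type _))
    (o : ∀ p : N, Orientation ℝ (TangentSpace (𝓡 3) p) (Fin 3))
    (u : N → ℝ) (A : ∀ p : N, TangentSpace (𝓡 3) p →L[ℝ] ℝ) : Prop where
  contMDiff_fun : ContMDiff (𝓡 3) 𝓘(ℝ) ∞ u
  pos : ∀ p, 0 < u p
  contMDiff_form : ContMDiff (𝓡 3) ((𝓡 3).prod 𝓘(ℝ, E3 →L[ℝ] ℝ)) ∞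
    (fun p => Bundle.TotalSpace.mk' (E3 →L[ℝ] ℝ)
      (E := fun p : N => TangentSpace (𝓡 3) p →L[ℝ] Bundle.Trivial N ℝ p) p (A p))
  monopole : MonopoleEquation h o u A

/-- `X` is a real-analytic vector field on `N × ℝ`. -/
def IsAnalyticVectorField (X : ∀ q : N × ℝ, TangentSpace ((𝓡 3).prod 𝓘(ℝ)) q) : Prop :=
  ContMDiff ((𝓡 3).prod 𝓘(ℝ)) ((𝓡 3).prod 𝓘(ℝ)).tangent ω
    (fun q => (⟨q, X q⟩ : TangentBundle ((𝓡 3).prod 𝓘(ℝ)) (N × ℝ)))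

/-- `σ` is a smooth section, over the nonempty open set `U`, of the projection `N × ℝ → N`. -/
structure IsLocalSection (U : Set N) (σ : N → N × ℝ) : Prop where
  isOpen : IsOpen U
  nonempty : U.Nonempty
  contMDiffOn : ContMDiffOn (𝓡 3) ((𝓡 3).prod 𝓘(ℝ)) ∞ σ U
  fst_eq : ∀ p ∈ U, (σ p).1 = p

end GibbonsHawking

end

/-! Let `Z` be the difference of the two flows. Subtracting the soliton equations cancels the Ricci
terms and leaves `ℒ_Z g = c g` with `c = 2 (b - a)`, so `Z` is homothetic, and it vanishes along the
hypersurface `σ(U)`.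

At a point of that hypersurface the derivative `K` of `Z` kills the tangent hyperplane, and since `Z
= 0` there, the homothety equation reduces to `g(K v, w) + g(v, K w) = c g(v, w)`. A nonzero tangent
vector `v = w` gives `c = 0`; then `K` is skew with a hyperplane in its kernel, hence zero
(`eq_zero_of_homothetic_of_comp_eq_zero`).

So `Z` is a Killing field with vanishing 1-jet at a point. The differentiated Killing equation and
the Koszul trick express its second derivative linearly in its 1-jet; Grönwall's inequality along
rays then makes `Z` vanish nearby (`IsHomotheticOn.eventually_eq_zero`). This step needs only a
`C^2` metric. Analyticity of the flows and connectedness of `N × ℝ` spread the equality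
(`eq_of_eventuallyEq_of_analytic`). Of the Gibbons–Hawking form, only the smoothness and positivity
of `g` and the codimension one of the section enter. -/

/-! ### Killing fields on an open subset of a vector space -/

section LocalKilling

set_option maxSynthPendingDepth 3

variable {E F : Type*} [NormedAddCommGroup E] [NormedSpace ℝ E]
  [NormedAddCommGroup F] [NormedSpace ℝ F]

/-- A function that vanishes at the centre of a ball and whose derivative is bounded by a multiple
of its norm vanishes on the whole ball. -/
theorem eq_zero_on_ball_of_norm_fderiv_le {f : E → F} {p : E} {r K : ℝ}
    (hf : ∀ x ∈ Metric.ball p r, DifferentiableAt ℝ f x) (hp : f p = 0)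
    (hbound : ∀ x ∈ Metric.ball p r, ‖fderiv ℝ f x‖ ≤ K * ‖f x‖) :
    ∀ x ∈ Metric.ball p r, f x = 0 := by
  intro x hx
  have hmem : ∀ t ∈ Set.Icc (0 : ℝ) 1, p + t • (x - p) ∈ Metric.ball p r := by
    intro t ht
    rw [mem_ball_iff_norm] at hx ⊢
    rw [add_sub_cancel_left, norm_smul, Real.norm_of_nonneg ht.1]
    exact lt_of_le_of_lt (mul_le_of_le_one_left (norm_nonneg _) ht.2) hx
  have hline : ∀ t : ℝ, HasDerivAt (fun t : ℝ => p + t • (x - p)) (x - p) t := by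
    intro t
    simpa using ((hasDerivAt_id t).smul_const (x - p)).const_add p
  have hder : ∀ t ∈ Set.Icc (0 : ℝ) 1, HasDerivAt (fun t : ℝ => f (p + t • (x - p)))
      (fderiv ℝ f (p + t • (x - p)) (x - p)) t := fun t ht =>
    ((hf _ (hmem t ht)).hasFDerivAt).comp_hasDerivAt t (hline t)
  -- Grönwall's inequality on the segment from `p` to `x`, whose velocity `x - p` contributes the
  -- factor `‖x - p‖`.
  have key := eq_zero_of_abs_deriv_le_mul_abs_self_of_eq_zero_right
    (f := fun t : ℝ => f (p + t • (x - p)))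
    (f' := fun t : ℝ => fderiv ℝ f (p + t • (x - p)) (x - p)) (K := K * ‖x - p‖) (a := 0) (b := 1)
    (fun t ht => (hder t ht).continuousAt.continuousWithinAt)
    (fun t ht => (hder t (Set.Ico_subset_Icc_self ht)).hasDerivWithinAt)
    (by simpa using hp) (fun t ht => by
      have h1 := hbound _ (hmem t (Set.Ico_subset_Icc_self ht))
      calc ‖fderiv ℝ f (p + t • (x - p)) (x - p)‖
          ≤ ‖fderiv ℝ f (p + t • (x - p))‖ * ‖x - p‖ := ContinuousLinearMap.le_opNorm _ _
        _ ≤ (K * ‖f (p + t • (x - p))‖) * ‖x - p‖ := by gcongr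
        _ = K * ‖x - p‖ * ‖f (p + t • (x - p))‖ := by ring)
  simpa using key 1 (by simp)

/-- `B` is a metric and `Z` a vector field on the set `V`, and `ℒ_Z B = c B`. -/
def IsHomotheticOn (c : ℝ) (B : E → E →L[ℝ] E →L[ℝ] ℝ) (Z : E → E) (V : Set E) : Prop :=
  ∀ x ∈ V, ∀ v w, fderiv ℝ B x (Z x) v w + B x (fderiv ℝ Z x v) w + B x v (fderiv ℝ Z x w)
    = c * B x v w

/-- At a zero of the field, the homothety equation only involves its derivative. -/
theorem IsHomotheticOn.of_eq_zero {c : ℝ} {B : E → E →L[ℝ] E →L[ℝ] ℝ} {Z : E → E} {V : Set E}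
    (hK : IsHomotheticOn c B Z V) {x : E} (hx : x ∈ V) (hZ : Z x = 0) (v w : E) :
    B x (fderiv ℝ Z x v) w + B x v (fderiv ℝ Z x w) = c * B x v w := by
  simpa [hZ] using hK x hx v w

/-- The Koszul formula: a trilinear form symmetric in its first two arguments is determined by its
symmetrization in the last two. -/
theorem two_mul_eq_of_symm_left {α : Type*} {T S : α → α → α → ℝ} (hT : ∀ u v w, T u v w = T v u w)
    (hS : ∀ u v w, T u v w + T u w v = S u v w) (u v w : α) :
    2 * T u v w = S u v w + S v u w - S w u v := by
  linarith [hS u v w, hS v u w, hS w u v, hT u v w, hT u w v, hT v w u]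

/-- The derivative of the Killing equation. -/
theorem IsHomotheticOn.deriv_eq {B : E → E →L[ℝ] E →L[ℝ] ℝ} {Z : E → E} {V : Set E}
    (hV : IsOpen V) (hB : ContDiffOn ℝ 2 B V) (hZ : ContDiffOn ℝ 2 Z V)
    (hK : IsHomotheticOn 0 B Z V) {x : E} (hx : x ∈ V) (u v w : E) :
    B x (fderiv ℝ (fderiv ℝ Z) x u v) w + B x v (fderiv ℝ (fderiv ℝ Z) x u w)
      = -(fderiv ℝ (fderiv ℝ B) x u (Z x) v w + fderiv ℝ B x (fderiv ℝ Z x u) v w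
        + fderiv ℝ B x u (fderiv ℝ Z x v) w + fderiv ℝ B x u v (fderiv ℝ Z x w)) := by
  have hBx := hB.contDiffAt (hV.mem_nhds hx)
  have hZx := hZ.contDiffAt (hV.mem_nhds hx)
  have dB : HasFDerivAt B (fderiv ℝ B x) x := (hBx.differentiableAt (by norm_num)).hasFDerivAt
  have dZ : HasFDerivAt Z (fderiv ℝ Z x) x := (hZx.differentiableAt (by norm_num)).hasFDerivAt
  have ddB : HasFDerivAt (fderiv ℝ B) (fderiv ℝ (fderiv ℝ B) x) x :=
    ((hBx.fderiv_right (m := 1) (by norm_num)).differentiableAt (by norm_num)).hasFDerivAt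
  have ddZ : HasFDerivAt (fderiv ℝ Z) (fderiv ℝ (fderiv ℝ Z) x) x :=
    ((hZx.fderiv_right (m := 1) (by norm_num)).differentiableAt (by norm_num)).hasFDerivAt
  have dv : ∀ v : E, HasFDerivAt (fun _ : E => v) (0 : E →L[ℝ] E) x :=
    fun v => hasFDerivAt_const v x
  have h1 := ((ddB.clm_apply dZ).clm_apply (dv v)).clm_apply (dv w)
  have h2 := (dB.clm_apply (ddZ.clm_apply (dv v))).clm_apply (dv w)
  have h3 := (dB.clm_apply (dv v)).clm_apply (ddZ.clm_apply (dv w))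
  have hsum := (h1.add h2).add h3
  -- For fixed `v` and `w` the left side of the Killing equation vanishes on a neighbourhood of `x`,
  -- so the derivative computed in `hsum` is zero.
  have hzero : HasFDerivAt (fun _ : E => (0 : ℝ)) (0 : E →L[ℝ] ℝ) x := hasFDerivAt_const 0 x
  have heq := (hzero.congr_of_eventuallyEq (f₁ := _) (by
    filter_upwards [hV.mem_nhds hx] with y hy
    simpa using hK y hy v w)).unique hsum
  have := congrArg (fun L => L u) heq
  simp at this
  linarith

/-- The first two derivatives of a `C^2` function are locally bounded. -/
theorem ContDiffAt.exists_norm_fderiv_le {f : E → F} {p : E} (hf : ContDiffAt ℝ 2 f p) :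
    ∃ M : ℝ, 0 ≤ M ∧ ∀ᶠ x in 𝓝 p, ‖fderiv ℝ f x‖ ≤ M ∧ ‖fderiv ℝ (fderiv ℝ f) x‖ ≤ M := by
  have c1 : ContinuousAt (fderiv ℝ f) p := (hf.fderiv_right (m := 1) (by norm_num)).continuousAt
  have c2 : ContinuousAt (fderiv ℝ (fderiv ℝ f)) p :=
    ((hf.fderiv_right (m := 1) (by norm_num)).fderiv_right (m := 0) (by norm_num)).continuousAt
  refine ⟨max ‖fderiv ℝ f p‖ ‖fderiv ℝ (fderiv ℝ f) p‖ + 1, by positivity, ?_⟩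
  have e1 := c1.norm.eventually_lt_const (lt_of_le_of_lt (le_max_left _ _) (lt_add_one
    (max ‖fderiv ℝ f p‖ ‖fderiv ℝ (fderiv ℝ f) p‖)))
  have e2 := c2.norm.eventually_lt_const (lt_of_le_of_lt (le_max_right _ _) (lt_add_one
    (max ‖fderiv ℝ f p‖ ‖fderiv ℝ (fderiv ℝ f) p‖)))
  filter_upwards [e1, e2] with x h1 h2 using ⟨h1.le, h2.le⟩

/-- A bound for the value of a continuous trilinear form. -/
theorem abs_trilinear_le {D : E →L[ℝ] E →L[ℝ] E →L[ℝ] ℝ} {M : ℝ} (hD : ‖D‖ ≤ M) (a b c : E) :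
    |D a b c| ≤ M * ‖a‖ * ‖b‖ * ‖c‖ :=
  calc |D a b c| ≤ ‖D a‖ * ‖b‖ * ‖c‖ := (D a).le_opNorm₂ b c
    _ ≤ (M * ‖a‖) * ‖b‖ * ‖c‖ := by
        gcongr
        exact D.le_of_opNorm_le hD a

/-- A bound for the value of a continuous quadrilinear form. -/
theorem abs_quadrilinear_le {D : E →L[ℝ] E →L[ℝ] E →L[ℝ] E →L[ℝ] ℝ} {M : ℝ} (hD : ‖D‖ ≤ M)
    (a b c d : E) : |D a b c d| ≤ M * ‖a‖ * ‖b‖ * ‖c‖ * ‖d‖ :=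
  abs_trilinear_le (D.le_of_opNorm_le hD a) b c d

/-- A bound for the right-hand side of the differentiated Killing equation. -/
theorem abs_add_forms_le {D : E →L[ℝ] E →L[ℝ] E →L[ℝ] ℝ} {DD : E →L[ℝ] E →L[ℝ] E →L[ℝ] E →L[ℝ] ℝ}
    {K : E →L[ℝ] E} {z : E} {M J : ℝ} (hD : ‖D‖ ≤ M) (hDD : ‖DD‖ ≤ M) (hz : ‖z‖ ≤ J) (hK : ‖K‖ ≤ J)
    (u v w : E) : |-(DD u z v w + D (K u) v w + D u (K v) w + D u v (K w))|
      ≤ 4 * (M * J * (‖u‖ * ‖v‖ * ‖w‖)) := by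
  have hM : 0 ≤ M := (norm_nonneg _).trans hD
  have hKa : ∀ a, ‖K a‖ ≤ J * ‖a‖ := K.le_of_opNorm_le hK
  have t1 : |DD u z v w| ≤ M * J * (‖u‖ * ‖v‖ * ‖w‖) :=
    calc _ ≤ _ := abs_quadrilinear_le hDD _ _ _ _
      _ ≤ M * ‖u‖ * J * ‖v‖ * ‖w‖ := by gcongr
      _ = _ := by ring
  have t2 : |D (K u) v w| ≤ M * J * (‖u‖ * ‖v‖ * ‖w‖) :=
    calc _ ≤ _ := abs_trilinear_le hD _ _ _
      _ ≤ M * (J * ‖u‖) * ‖v‖ * ‖w‖ := by gcongr; exact hKa u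
      _ = _ := by ring
  have t3 : |D u (K v) w| ≤ M * J * (‖u‖ * ‖v‖ * ‖w‖) :=
    calc _ ≤ _ := abs_trilinear_le hD _ _ _
      _ ≤ M * ‖u‖ * (J * ‖v‖) * ‖w‖ := by gcongr; exact hKa v
      _ = _ := by ring
  have t4 : |D u v (K w)| ≤ M * J * (‖u‖ * ‖v‖ * ‖w‖) :=
    calc _ ≤ _ := abs_trilinear_le hD _ _ _
      _ ≤ M * ‖u‖ * ‖v‖ * (J * ‖w‖) := by gcongr; exact hKa w
      _ = _ := by ring
  rw [abs_le] at *
  constructor <;> linarith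

/-- Bilinear forms close to a nondegenerate one are uniformly nondegenerate. -/
theorem exists_norm_le_mul_norm_apply [FiniteDimensional ℝ E] {b : E →L[ℝ] F}
    (hb : Function.Injective b) :
    ∃ k : ℝ, 0 ≤ k ∧ ∀ᶠ b' in 𝓝 b, ∀ z, ‖z‖ ≤ k * ‖b' z‖ := by
  obtain ⟨k, hk, hanti⟩ := LinearMap.exists_antilipschitzWith b.toLinearMap
    (LinearMap.ker_eq_bot.2 hb)
  have hk' : (0 : ℝ) < k := by exact_mod_cast hk
  -- A perturbation of norm below `1 / (2k)` costs at most `‖z‖ / 2`, which is absorbed on the left;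
  -- this doubles the constant.
  refine ⟨2 * k, by positivity, ?_⟩
  filter_upwards [Metric.ball_mem_nhds b (ε := (2 * (k : ℝ))⁻¹) (by positivity)] with b' hb' z
  rw [mem_ball_iff_norm, norm_sub_rev] at hb'
  have hlow : ‖z‖ ≤ k * ‖b z‖ := by simpa using hanti.le_mul_dist z 0
  have h2 : ‖b z‖ ≤ ‖b' z‖ + (2 * (k : ℝ))⁻¹ * ‖z‖ := by
    have : b z = b' z + (b - b') z := by simp
    rw [this]
    exact (norm_add_le _ _).trans (by gcongr; exact (b - b').le_of_opNorm_le hb'.le z)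
  have h3 : k * ‖b z‖ ≤ k * (‖b' z‖ + (2 * (k : ℝ))⁻¹ * ‖z‖) := by gcongr
  have h4 : k * (‖b' z‖ + (2 * (k : ℝ))⁻¹ * ‖z‖) = k * ‖b' z‖ + 1 / 2 * ‖z‖ := by
    field_simp
  linarith

/-! ### Killing fields are determined by their 1-jet -/

/-- The second derivative of a Killing field is bounded by its 1-jet, near each point. -/
theorem IsHomotheticOn.exists_norm_fderiv_fderiv_le [FiniteDimensional ℝ E]
    {B : E → E →L[ℝ] E →L[ℝ] ℝ} {Z : E → E}
    {V : Set E} (hV : IsOpen V) (hB : ContDiffOn ℝ 2 B V) (hZ : ContDiffOn ℝ 2 Z V)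
    (hsymm : ∀ x ∈ V, ∀ v w, B x v w = B x w v) (hpos : ∀ x ∈ V, ∀ v, v ≠ 0 → 0 < B x v v)
    (hK : IsHomotheticOn 0 B Z V) {p : E} (hp : p ∈ V) :
    ∃ C : ℝ, 0 ≤ C ∧ ∀ᶠ x in 𝓝 p, ‖fderiv ℝ (fderiv ℝ Z) x‖ ≤ C * max ‖Z x‖ ‖fderiv ℝ Z x‖ := by
  have hBp := hB.contDiffAt (hV.mem_nhds hp)
  have hinj : Function.Injective (B p) := by
    rw [injective_iff_map_eq_zero]
    intro v hv
    by_contra h0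
    have := hpos p hp v h0
    simp [hv] at this
  obtain ⟨k, hk, hlow⟩ := exists_norm_le_mul_norm_apply hinj
  obtain ⟨M, hM, hbd⟩ := hBp.exists_norm_fderiv_le
  -- The Koszul formula has three terms, each bounded with constant `4 * M`, and is halved: hence `6
  -- * M`. The factor `k` inverts the metric.
  refine ⟨k * (6 * M), by positivity, ?_⟩
  filter_upwards [hbd, hBp.continuousAt.eventually hlow, hV.mem_nhds hp] with x hx12 hlow hx
  set J := max ‖Z x‖ ‖fderiv ℝ Z x‖
  have hJ0 : 0 ≤ J := le_max_of_le_left (norm_nonneg _)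
  have hsym2 : ∀ u v, fderiv ℝ (fderiv ℝ Z) x u v = fderiv ℝ (fderiv ℝ Z) x v u := fun u v =>
    (hZ.contDiffAt (hV.mem_nhds hx)).isSymmSndFDerivAt (by simp) u v
  have hT : ∀ u v w, |B x (fderiv ℝ (fderiv ℝ Z) x u v) w|
      ≤ 6 * M * J * ‖u‖ * ‖v‖ * ‖w‖ := by
    intro u v w
    -- `S` is the right side of the differentiated Killing equation, where no second derivative of
    -- `Z` occurs.
    obtain ⟨S, hSeq, hS⟩ : ∃ S : E → E → E → ℝ,
        (∀ u v w, B x (fderiv ℝ (fderiv ℝ Z) x u v) w + B x (fderiv ℝ (fderiv ℝ Z) x u w) v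
          = S u v w) ∧ ∀ u v w, |S u v w| ≤ 4 * (M * J * (‖u‖ * ‖v‖ * ‖w‖)) := by
      refine ⟨_, fun u v w => ?_, abs_add_forms_le hx12.1 hx12.2 (le_max_left ‖Z x‖ ‖fderiv ℝ Z x‖)
        (le_max_right ‖Z x‖ ‖fderiv ℝ Z x‖)⟩
      rw [← hK.deriv_eq hV hB hZ hx u v w, hsymm x hx v]
    have key := two_mul_eq_of_symm_left (T := fun u v w => B x (fderiv ℝ (fderiv ℝ Z) x u v) w)
      (fun u v w => by simp only [hsym2 u v]) hSeq u v w
    have a1 := abs_le.1 (hS u v w)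
    have a2 := abs_le.1 (hS v u w)
    have a3 := abs_le.1 (hS w u v)
    rw [abs_le]
    constructor <;> linarith
  refine ContinuousLinearMap.opNorm_le_bound₂ _ (by positivity) fun u v => ?_
  calc ‖fderiv ℝ (fderiv ℝ Z) x u v‖ ≤ k * ‖B x (fderiv ℝ (fderiv ℝ Z) x u v)‖ := hlow _
    _ ≤ k * (6 * M * J * ‖u‖ * ‖v‖) := by
        gcongr
        exact ContinuousLinearMap.opNorm_le_bound _ (by positivity) fun w => hT u v w
    _ = _ := by ring

/-- A Killing field whose 1-jet vanishes at a point vanishes near that point. -/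
theorem IsHomotheticOn.eventually_eq_zero [FiniteDimensional ℝ E]
    {B : E → E →L[ℝ] E →L[ℝ] ℝ} {Z : E → E}
    {V : Set E} (hV : IsOpen V) (hB : ContDiffOn ℝ 2 B V) (hZ : ContDiffOn ℝ 2 Z V)
    (hsymm : ∀ x ∈ V, ∀ v w, B x v w = B x w v) (hpos : ∀ x ∈ V, ∀ v, v ≠ 0 → 0 < B x v v)
    (hK : IsHomotheticOn 0 B Z V) {p : E} (hp : p ∈ V) (hZp : Z p = 0) (hdZp : fderiv ℝ Z p = 0) :
    ∀ᶠ x in 𝓝 p, Z x = 0 := by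
  obtain ⟨C, hC, hbd⟩ := hK.exists_norm_fderiv_fderiv_le hV hB hZ hsymm hpos hp
  obtain ⟨r, hr, hball⟩ := Metric.eventually_nhds_iff_ball.1 (hbd.and (hV.mem_nhds hp))
  have hder : ∀ x ∈ Metric.ball p r, HasFDerivAt (fun y => (Z y, fderiv ℝ Z y))
      ((fderiv ℝ Z x).prod (fderiv ℝ (fderiv ℝ Z) x)) x := by
    intro x hx
    have hZx := hZ.contDiffAt (hV.mem_nhds (hball x hx).2)
    exact (hZx.differentiableAt (by norm_num)).hasFDerivAt.prodMk
      ((hZx.fderiv_right (m := 1) (by norm_num)).differentiableAt (by norm_num)).hasFDerivAt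
  have key := eq_zero_on_ball_of_norm_fderiv_le (f := fun y => (Z y, fderiv ℝ Z y)) (p := p)
    (r := r) (K := max 1 C) (fun x hx => (hder x hx).differentiableAt) (by simp [hZp, hdZp])
    (fun x hx => by
      rw [(hder x hx).fderiv, ContinuousLinearMap.opNorm_prod, Prod.norm_def, Prod.norm_def]
      have hJ : 0 ≤ max ‖Z x‖ ‖fderiv ℝ Z x‖ := le_max_of_le_left (norm_nonneg _)
      refine max_le ?_ ((hball x hx).1.trans (by gcongr; exact le_max_right _ _))
      calc ‖fderiv ℝ Z x‖ ≤ 1 * max ‖Z x‖ ‖fderiv ℝ Z x‖ := by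
            rw [one_mul]; exact le_max_right _ _
        _ ≤ _ := by gcongr; exact le_max_left _ _)
  filter_upwards [Metric.ball_mem_nhds p hr] with x hx
  exact congrArg Prod.fst (key x hx)

/-! ### Linear algebra at a zero of the field -/

/-- An endomorphism that satisfies the homothety equation and vanishes on a graph over a hyperplane
direction is zero, with zero homothety constant. -/
theorem eq_zero_of_homothetic_of_comp_eq_zero {F : Type*} [NormedAddCommGroup F] [NormedSpace ℝ F]
    [Nontrivial F] {b : F × ℝ →L[ℝ] F × ℝ →L[ℝ] ℝ} (hpos : ∀ v, v ≠ 0 → 0 < b v v)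
    (hsymm : ∀ v w, b v w = b w v) {K : F × ℝ →L[ℝ] F × ℝ} {c : ℝ}
    (hK : ∀ v w, b (K v) w + b v (K w) = c * b v w)
    {L : F →L[ℝ] F × ℝ} (hL : ∀ v, (L v).1 = v) (hKL : ∀ v, K (L v) = 0) :
    c = 0 ∧ K = 0 := by
  -- On a nonzero vector `L v` the left side of `hK` vanishes while `b (L v) (L v)` is positive.
  have hc : c = 0 := by
    obtain ⟨v, hv⟩ := exists_ne (0 : F)
    have h1 := hK (L v) (L v)
    have h2 := hpos (L v) (fun h => hv (by rw [← hL v, h]; rfl))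
    simp only [hKL, map_zero, zero_apply, add_zero] at h1
    exact (mul_eq_zero.1 h1.symm).resolve_right h2.ne'
  subst hc
  have hdec : ∀ e : F × ℝ, e = L e.1 + (e.2 - (L e.1).2) • ((0, 1) : F × ℝ) := by
    intro e
    ext <;> simp [hL]
  set n : F × ℝ := (0, 1)
  -- By skewness `K n` is orthogonal to the image of `L` and to `n`. These span, so `K n` is
  -- orthogonal to itself.
  have h1 : ∀ v, b (K n) (L v) = 0 := by
    intro v
    have := hK n (L v)
    simpa [hKL] using this
  have h2 : b (K n) n = 0 := by
    have := hK n n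
    rw [hsymm n (K n)] at this
    linarith
  have h3 : K n = 0 := by
    by_contra h0
    have := hpos _ h0
    have h4 : b (K n) (K n) = 0 := by
      conv_lhs => rw [hdec (K n)]
      rw [← hdec (K n)]
      have := congrArg (b (K n)) (hdec (K n))
      rw [this, map_add, map_smul, h1, h2]
      simp
    linarith
  refine ⟨rfl, ?_⟩
  refine ContinuousLinearMap.ext fun e => ?_
  rw [hdec e, map_add, map_smul, hKL, h3]
  simp

end LocalKilling

/-! ### Vector fields and tensors read in charts -/

section ChartExpressions

set_option maxSynthPendingDepth 3

variable {E : Type*} [NormedAddCommGroup E] [NormedSpace ℝ E]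
  {H : Type*} [TopologicalSpace H] {I : ModelWithCorners ℝ E H}
  {M : Type*} [TopologicalSpace M] [ChartedSpace H M]

theorem isInvertible_chartSymmDeriv [IsManifold I 1 M] (p : M) {x : E}
    (hx : x ∈ (extChartAt I p).target) : (chartSymmDeriv I p x).IsInvertible :=
  isInvertible_mfderivWithin_extChartAt_symm hx

/-- Pullback by the inverse chart applies an invertible linear map pointwise, so fields can be
compared through their `E`-valued expressions. -/
theorem vectorFieldInChart_eq_iff [IsManifold I 1 M] {X Y : ∀ q : M, TangentSpace I q} (p : M)
    {x : E} (hx : x ∈ (extChartAt I p).target) :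
    vectorFieldInChart I X p x = vectorFieldInChart I Y p x ↔
      X ((extChartAt I p).symm x) = Y ((extChartAt I p).symm x) := by
  simp only [vectorFieldInChart, VectorField.mpullbackWithin_apply]
  exact (isInvertible_chartSymmDeriv p hx).inverse.injective.eq_iff

variable [I.Boundaryless]

/-- These are the constant-coefficient fields of the chart, obtained from a constant section by the
tangent map of the inverse chart. Tensor components are evaluated on them. -/
theorem contMDiffOn_chartSymmDeriv [IsManifold I ∞ M] (p : M) (v : E) :
    ContMDiffOn 𝓘(ℝ, E) I.tangent ∞
      (fun x => (⟨(extChartAt I p).symm x, chartSymmDeriv I p x v⟩ : TangentBundle I M))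
      (extChartAt I p).target := by
  have hopen : IsOpen (extChartAt I p).target := isOpen_extChartAt_target p
  have h1 : ContMDiffOn 𝓘(ℝ, E).tangent I.tangent ∞
      (tangentMapWithin 𝓘(ℝ, E) I (extChartAt I p).symm (extChartAt I p).target) _ :=
    (contMDiffOn_extChartAt_symm (n := ∞) p).contMDiffOn_tangentMapWithin (m := ∞) (by simp)
      hopen.uniqueMDiffOn
  have h2 : ContMDiff 𝓘(ℝ, E) 𝓘(ℝ, E).tangent ∞
      (fun x : E => (⟨x, (v : TangentSpace 𝓘(ℝ, E) x)⟩ : TangentBundle 𝓘(ℝ, E) E)) :=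
    contMDiff_vectorSpace_iff_contDiff.2 contDiff_const
  refine (h1.comp h2.contMDiffOn (fun x hx => hx)).congr fun x hx => ?_
  simp only [Function.comp_apply, tangentMapWithin, chartSymmDeriv]
  rw [I.range_eq_univ, mfderivWithin_univ, mfderivWithin_of_isOpen hopen hx]
  rfl

variable [FiniteDimensional ℝ E]

theorem analyticOnNhd_vectorFieldInChart [IsManifold I ω M] {X : ∀ q : M, TangentSpace I q}
    (hX : ContMDiff I I.tangent ω (fun q => (⟨q, X q⟩ : TangentBundle I M))) (p : M) :
    AnalyticOnNhd ℝ (vectorFieldInChart I X p) (extChartAt I p).target := by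
  have : CompleteSpace E := FiniteDimensional.complete ℝ E
  have hopen : IsOpen (extChartAt I p).target := isOpen_extChartAt_target p
  rw [← hopen.analyticOn_iff_analyticOnNhd, ← contDiffOn_omega_iff_analyticOn hopen.uniqueDiffOn]
  refine contMDiffOn_vectorSpace_iff_contDiffOn.1 fun x hx => ?_
  have h1 : ContMDiffWithinAt 𝓘(ℝ, E) I ω (extChartAt I p).symm (Set.range I) x := by
    rw [I.range_eq_univ]
    exact ((contMDiffOn_extChartAt_symm (n := ω) p).contMDiffAt (hopen.mem_nhds hx))
  exact (ContMDiffWithinAt.mpullbackWithin_vectorField_of_mem (m := ω) (n := ω) (t := Set.univ)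
    (hX _).contMDiffWithinAt h1 (isInvertible_mfderivWithin_extChartAt_symm hx)
    (by simp [I.range_eq_univ]) (by rw [I.range_eq_univ]; exact uniqueMDiffOn_univ) (by simp)
    (by simp)).mono (by simp [I.range_eq_univ])

/-- On a connected analytic manifold, analytic vector fields that agree near one point are equal. -/
theorem eq_of_eventuallyEq_of_analytic [IsManifold I ω M] [PreconnectedSpace M]
    {X Y : ∀ q : M, TangentSpace I q}
    (hX : ContMDiff I I.tangent ω (fun q => (⟨q, X q⟩ : TangentBundle I M)))
    (hY : ContMDiff I I.tangent ω (fun q => (⟨q, Y q⟩ : TangentBundle I M)))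
    {p : M} (hp : ∀ᶠ q in 𝓝 p, X q = Y q) : X = Y := by
  set S : Set M := {q | ∀ᶠ q' in 𝓝 q, X q' = Y q'}
  have hSo : IsOpen S := isOpen_iff_mem_nhds.2 fun q hq => eventually_eventually_nhds.2 hq
  have hSc : IsClosed S := by
    refine isClosed_of_closure_subset fun q hq => ?_
    -- A chart ball around a closure point `q` meets `S`; the identity theorem on this convex ball
    -- gives equality on all of it, so `q` lies in `S`.
    obtain ⟨r, hr, hball⟩ := Metric.isOpen_iff.1 (isOpen_extChartAt_target (I := I) q) _
      (mem_extChartAt_target q)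
    have hZ := ((analyticOnNhd_vectorFieldInChart hX q).mono hball).sub
      ((analyticOnNhd_vectorFieldInChart hY q).mono hball)
    have hmem : ∀ᶠ q' in 𝓝 q, extChartAt I q q' ∈ Metric.ball (extChartAt I q q) r ∧
        q' ∈ (extChartAt I q).source :=
      ((continuousAt_extChartAt q).eventually_mem (Metric.ball_mem_nhds _ hr)).and
        (extChartAt_source_mem_nhds q)
    obtain ⟨q', ⟨hq'r, hq's⟩, hq'S⟩ := mem_closure_iff_nhds.1 hq _ hmem
    have hloc : (vectorFieldInChart I X q - vectorFieldInChart I Y q)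
        =ᶠ[𝓝 (extChartAt I q q')] 0 := by
      have hcont : ContinuousAt (extChartAt I q).symm (extChartAt I q q') :=
        continuousAt_extChartAt_symm' hq's
      rw [ContinuousAt, (extChartAt I q).left_inv hq's] at hcont
      filter_upwards [hcont.eventually hq'S, Metric.isOpen_ball.mem_nhds hq'r] with x hx hxb
      exact sub_eq_zero.2 ((vectorFieldInChart_eq_iff q (hball hxb)).2 hx)
    have hzero := hZ.eqOn_zero_of_preconnected_of_eventuallyEq_zero
      (convex_ball _ _).isPreconnected hq'r hloc
    show ∀ᶠ q' in 𝓝 q, X q' = Y q'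
    filter_upwards [hmem] with y hy
    have := (vectorFieldInChart_eq_iff (X := X) (Y := Y) q (hball hy.1)).1
      (sub_eq_zero.1 (hzero hy.1))
    rwa [(extChartAt I q).left_inv hy.2] at this
  have hSu : S = Set.univ := IsClopen.eq_univ ⟨hSc, hSo⟩ ⟨p, hp⟩
  funext q
  have hq : q ∈ S := hSu ▸ Set.mem_univ q
  exact Filter.Eventually.self_of_nhds (p := fun q => X q = Y q) hq

end ChartExpressions

/-! ### The Gibbons–Hawking metric in charts -/

section GibbonsHawkingChart

set_option maxSynthPendingDepth 3

variable {N : Type*} [TopologicalSpace N] [ChartedSpace E3 N]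
  (A : ∀ p : N, TangentSpace (𝓡 3) p →L[ℝ] ℝ)

/-- A smooth local section, read in charts around one of its points, is a graph. -/
theorem IsLocalSection.exists_graph {U : Set N} {σ : N → N × ℝ} (hσ : IsLocalSection U σ) {p : N}
    (hp : p ∈ U) : ∃ (s : E3 → E3 × ℝ) (L : E3 →L[ℝ] E3 × ℝ) (x₀ : E3), HasFDerivAt s L x₀ ∧
      s x₀ = extChartAt ((𝓡 3).prod 𝓘(ℝ)) (σ p) (σ p) ∧ ∀ᶠ x in 𝓝 x₀, (s x).1 = x ∧
        s x ∈ (extChartAt ((𝓡 3).prod 𝓘(ℝ)) (σ p)).target ∧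
        ∃ q ∈ U, (extChartAt ((𝓡 3).prod 𝓘(ℝ)) (σ p)).symm (s x) = σ q := by
  have hsm := hσ.contMDiffOn.contMDiffAt (hσ.isOpen.mem_nhds hp)
  have hd := (hsm.mdifferentiableAt (by simp)).differentiableWithinAt_writtenInExtChartAt
  rw [ModelWithCorners.range_eq_univ, differentiableWithinAt_univ] at hd
  refine ⟨_, _, _, hd.hasFDerivAt, by simp [writtenInExtChartAt], ?_⟩
  have hcont : ContinuousAt (extChartAt (𝓡 3) p).symm (extChartAt (𝓡 3) p p) :=
    continuousAt_extChartAt_symm p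
  rw [ContinuousAt, extChartAt_to_inv] at hcont
  have hsrc : ∀ᶠ q in 𝓝 p, σ q ∈ (extChartAt ((𝓡 3).prod 𝓘(ℝ)) (σ p)).source :=
    hsm.continuousAt.eventually (extChartAt_source_mem_nhds (σ p))
  filter_upwards [hcont.eventually hsrc, hcont.eventually (hσ.isOpen.mem_nhds hp),
    (isOpen_extChartAt_target (I := 𝓡 3) p).mem_nhds (mem_extChartAt_target p)] with x hxs hxU hxt
  refine ⟨?_, (extChartAt ((𝓡 3).prod 𝓘(ℝ)) (σ p)).map_source hxs, _, hxU,
    (extChartAt ((𝓡 3).prod 𝓘(ℝ)) (σ p)).left_inv hxs⟩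
  -- The chart at `σ p` is a product whose first factor is the chart at `(σ p).1 = p`, so the first
  -- component of the graph map is the identity.
  simp only [writtenInExtChartAt, Function.comp_apply, extChartAt_prod, PartialEquiv.prod_coe,
    hσ.fst_eq p hp]
  rw [hσ.fst_eq _ hxU]
  exact (extChartAt (𝓡 3) p).right_inv hxt

theorem connectionForm_add (q : N × ℝ) (v w : TangentSpace ((𝓡 3).prod 𝓘(ℝ)) q) :
    connectionForm A q (v + w) = connectionForm A q v + connectionForm A q w := by
  simp only [connectionForm, map_add]
  ring

theorem connectionForm_smul (q : N × ℝ) (c : ℝ) (v : TangentSpace ((𝓡 3).prod 𝓘(ℝ)) q) :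
    connectionForm A q (c • v) = c * connectionForm A q v := by
  simp only [connectionForm, map_smul, smul_eq_mul]
  ring

variable [IsManifold (𝓡 3) ω N]
  (h : Bundle.ContMDiffRiemannianMetric (𝓡 3) ω E3 (TangentSpace (𝓡 3) : N → Type _))
  (u : N → ℝ)

theorem gibbonsHawkingMetric_symm (q : N × ℝ) (v w : TangentSpace ((𝓡 3).prod 𝓘(ℝ)) q) :
    gibbonsHawkingMetric h u A q v w = gibbonsHawkingMetric h u A q w v := by
  simp only [gibbonsHawkingMetric]
  rw [h.symm, mul_comm (connectionForm A q v)]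

/-- Both summands are nonnegative. When the projection of `v` to `N` vanishes, `θ(v)` is just
`dt(v)`, which is then nonzero. -/
theorem gibbonsHawkingMetric_pos (q : N × ℝ) (hu : 0 < u q.1)
    {v : TangentSpace ((𝓡 3).prod 𝓘(ℝ)) q} (hv : v ≠ 0) :
    0 < gibbonsHawkingMetric h u A q v v := by
  have hθ : 0 ≤ (u q.1)⁻¹ * (connectionForm A q v * connectionForm A q v) :=
    mul_nonneg (inv_nonneg.2 hu.le) (mul_self_nonneg _)
  by_cases h0 : mfderiv ((𝓡 3).prod 𝓘(ℝ)) (𝓡 3) (Prod.fst : N × ℝ → N) q v = 0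
  · have hsnd : connectionForm A q v ≠ 0 := by
      intro h1
      simp only [connectionForm, h0, map_zero, add_zero] at h1
      rw [mfderiv_fst] at h0
      simp only [mvfderiv, mfderiv_snd] at h1
      exact hv (Prod.ext h0 h1)
    simp only [gibbonsHawkingMetric, h0, map_zero, mul_zero, zero_add]
    exact mul_pos (inv_pos.2 hu) (mul_self_pos.2 hsnd)
  · exact add_pos_of_pos_of_nonneg (mul_pos hu (h.pos _ _ h0)) hθ

/-- The Gibbons–Hawking metric in the preferred chart at `p`, as a bilinear-form-valued function. -/
noncomputable def gibbonsHawkingInChart (p : N × ℝ) (x : E3 × ℝ) :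
    E3 × ℝ →L[ℝ] E3 × ℝ →L[ℝ] ℝ :=
  (LinearMap.mk₂ ℝ (tensorInChart ((𝓡 3).prod 𝓘(ℝ)) (gibbonsHawkingMetric h u A) p x)
    (fun v v' w => by
      simp only [tensorInChart, gibbonsHawkingMetric, map_add, connectionForm_add, add_apply]
      ring)
    (fun c v w => by
      simp only [tensorInChart, gibbonsHawkingMetric, map_smul, connectionForm_smul, smul_apply,
        smul_eq_mul]
      ring)
    (fun v w w' => by
      simp only [tensorInChart, gibbonsHawkingMetric, map_add, connectionForm_add]
      ring)
    (fun c v w => by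
      simp only [tensorInChart, gibbonsHawkingMetric, map_smul, connectionForm_smul, smul_eq_mul]
      ring)).toContinuousBilinearMap

theorem gibbonsHawkingInChart_apply (p : N × ℝ) (x v w : E3 × ℝ) :
    gibbonsHawkingInChart A h u p x v w
      = tensorInChart ((𝓡 3).prod 𝓘(ℝ)) (gibbonsHawkingMetric h u A) p x v w := rfl

variable {h u A}

theorem gibbonsHawkingInChart_pos (hu : ∀ p, 0 < u p) (p : N × ℝ) {x : E3 × ℝ}
    (hx : x ∈ (extChartAt ((𝓡 3).prod 𝓘(ℝ)) p).target) {v : E3 × ℝ} (hv : v ≠ 0) :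
    0 < gibbonsHawkingInChart A h u p x v v := by
  refine gibbonsHawkingMetric_pos A h u _ (hu _) fun h0 => hv ?_
  exact (isInvertible_chartSymmDeriv p hx).injective (h0.trans (map_zero _).symm)

/-- In finite dimension it suffices to treat each component, on which `h`, `dt` and `A` are smooth
bundle maps applied to constant-coefficient chart fields. -/
theorem contDiffOn_gibbonsHawkingInChart (hu : ContMDiff (𝓡 3) 𝓘(ℝ) ∞ u) (hpos : ∀ p, 0 < u p)
    (hA : ContMDiff (𝓡 3) ((𝓡 3).prod 𝓘(ℝ, E3 →L[ℝ] ℝ)) ∞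
      (fun p => Bundle.TotalSpace.mk' (E3 →L[ℝ] ℝ)
        (E := fun p : N => TangentSpace (𝓡 3) p →L[ℝ] Bundle.Trivial N ℝ p) p (A p)))
    (p : N × ℝ) :
    ContDiffOn ℝ ∞ (gibbonsHawkingInChart A h u p) (extChartAt ((𝓡 3).prod 𝓘(ℝ)) p).target := by
  set T := (extChartAt ((𝓡 3).prod 𝓘(ℝ)) p).target
  have hV : ∀ v : E3 × ℝ, ContMDiffOn 𝓘(ℝ, E3 × ℝ) ((𝓡 3).prod 𝓘(ℝ)).tangent ∞ _ T :=
    fun v => contMDiffOn_chartSymmDeriv p v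
  have hsymm : ContMDiffOn 𝓘(ℝ, E3 × ℝ) ((𝓡 3).prod 𝓘(ℝ)) ∞
    (extChartAt ((𝓡 3).prod 𝓘(ℝ)) p).symm T := contMDiffOn_extChartAt_symm p
  have hb : ContMDiffOn 𝓘(ℝ, E3 × ℝ) (𝓡 3) ∞
      (fun x => ((extChartAt ((𝓡 3).prod 𝓘(ℝ)) p).symm x).1) T :=
    contMDiff_fst.comp_contMDiffOn hsymm
  have hfst : ∀ v : E3 × ℝ, ContMDiffOn 𝓘(ℝ, E3 × ℝ) (𝓡 3).tangent ∞
      (fun x => (⟨((extChartAt ((𝓡 3).prod 𝓘(ℝ)) p).symm x).1,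
        mfderiv ((𝓡 3).prod 𝓘(ℝ)) (𝓡 3) (Prod.fst : N × ℝ → N)
          ((extChartAt ((𝓡 3).prod 𝓘(ℝ)) p).symm x)
          (chartSymmDeriv ((𝓡 3).prod 𝓘(ℝ)) p x v)⟩ : TangentBundle (𝓡 3) N)) T := fun v =>
    ((contMDiff_fst (n := ∞)).contMDiff_tangentMap (m := ∞) (by simp)).comp_contMDiffOn (hV v)
  have hsnd : ∀ v : E3 × ℝ, ContMDiffOn 𝓘(ℝ, E3 × ℝ) 𝓘(ℝ) ∞
      (fun x => mvfderiv ((𝓡 3).prod 𝓘(ℝ)) (Prod.snd : N × ℝ → ℝ)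
        ((extChartAt ((𝓡 3).prod 𝓘(ℝ)) p).symm x)
        (chartSymmDeriv ((𝓡 3).prod 𝓘(ℝ)) p x v)) T := fun v =>
    (contMDiff_snd_tangentBundle_modelSpace ℝ 𝓘(ℝ)).comp_contMDiffOn
      (((contMDiff_snd (n := ∞)).contMDiff_tangentMap (m := ∞) (by simp)).comp_contMDiffOn (hV v))
  have hθ : ∀ v : E3 × ℝ, ContMDiffOn 𝓘(ℝ, E3 × ℝ) 𝓘(ℝ) ∞
      (fun x => connectionForm A ((extChartAt ((𝓡 3).prod 𝓘(ℝ)) p).symm x)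
        (chartSymmDeriv ((𝓡 3).prod 𝓘(ℝ)) p x v)) T := fun v => by
    refine (hsnd v).add fun x hx => ?_
    have := ContMDiffOn.clm_bundle_apply (F₁ := E3) (F₂ := ℝ) (E₂ := Bundle.Trivial N ℝ)
      (hA.comp_contMDiffOn hb) (hfst v) x hx
    simp only [Bundle.contMDiffWithinAt_totalSpace] at this
    exact this.2
  have hh : ∀ v w : E3 × ℝ, ContMDiffOn 𝓘(ℝ, E3 × ℝ) 𝓘(ℝ) ∞
      (fun x => h.inner ((extChartAt ((𝓡 3).prod 𝓘(ℝ)) p).symm x).1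
        (mfderiv ((𝓡 3).prod 𝓘(ℝ)) (𝓡 3) (Prod.fst : N × ℝ → N)
          ((extChartAt ((𝓡 3).prod 𝓘(ℝ)) p).symm x) (chartSymmDeriv ((𝓡 3).prod 𝓘(ℝ)) p x v))
        (mfderiv ((𝓡 3).prod 𝓘(ℝ)) (𝓡 3) (Prod.fst : N × ℝ → N)
          ((extChartAt ((𝓡 3).prod 𝓘(ℝ)) p).symm x)
          (chartSymmDeriv ((𝓡 3).prod 𝓘(ℝ)) p x w))) T := fun v w x hx => by
    have := ContMDiffWithinAt.clm_bundle_apply₂ (F₁ := E3) (F₂ := E3) (F₃ := ℝ)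
      (E₃ := Bundle.Trivial N ℝ)
      ((h.contMDiff.of_le le_top).comp_contMDiffOn hb x hx) (hfst v x hx) (hfst w x hx)
    simp only [Bundle.contMDiffWithinAt_totalSpace] at this
    exact this.2
  have hub := hu.comp_contMDiffOn hb
  have huinv := hub.inv₀ fun x _ => (hpos _).ne'
  refine contDiffOn_clm_apply.2 fun v => contDiffOn_clm_apply.2 fun w => ?_
  rw [← contMDiffOn_iff_contDiffOn]
  exact (hub.mul (hh v w)).add (huinv.mul ((hθ v).mul (hθ w)))

/-- The difference of two soliton flows is homothetic, in every chart. -/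
theorem SolitonEquation.isHomotheticOn_sub {X Y : ∀ q : N × ℝ, TangentSpace ((𝓡 3).prod 𝓘(ℝ)) q}
    {a b : ℝ} (hX : SolitonEquation ((𝓡 3).prod 𝓘(ℝ)) (gibbonsHawkingMetric h u A) X a)
    (hY : SolitonEquation ((𝓡 3).prod 𝓘(ℝ)) (gibbonsHawkingMetric h u A) Y b) (p : N × ℝ)
    (hB : ∀ x ∈ (extChartAt ((𝓡 3).prod 𝓘(ℝ)) p).target,
      DifferentiableAt ℝ (gibbonsHawkingInChart A h u p) x)
    (hXd : ∀ x ∈ (extChartAt ((𝓡 3).prod 𝓘(ℝ)) p).target,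
      DifferentiableAt ℝ (vectorFieldInChart ((𝓡 3).prod 𝓘(ℝ)) X p) x)
    (hYd : ∀ x ∈ (extChartAt ((𝓡 3).prod 𝓘(ℝ)) p).target,
      DifferentiableAt ℝ (vectorFieldInChart ((𝓡 3).prod 𝓘(ℝ)) Y p) x) :
    IsHomotheticOn (2 * (b - a)) (gibbonsHawkingInChart A h u p)
      (vectorFieldInChart ((𝓡 3).prod 𝓘(ℝ)) X p - vectorFieldInChart ((𝓡 3).prod 𝓘(ℝ)) Y p)
      (extChartAt ((𝓡 3).prod 𝓘(ℝ)) p).target := by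
  intro x hx v w
  have h1 := hX p x hx v w
  have h2 := hY p x hx v w
  -- `CoordCalc.lieDeriv` differentiates scalar components, `IsHomotheticOn` the form-valued map;
  -- this identifies the two.
  have hder : fderiv ℝ (fun y => gibbonsHawkingInChart A h u p y v w) x
      = ((fderiv ℝ (gibbonsHawkingInChart A h u p) x).flip v).flip w := by
    have := ((hB x hx).hasFDerivAt.clm_apply (hasFDerivAt_const v x)).clm_apply
      (hasFDerivAt_const w x)
    refine this.fderiv.trans ?_
    simp
  simp only [CoordCalc.lieDeriv, ← gibbonsHawkingInChart_apply, hder] at h1 h2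
  rw [fderiv_sub (hXd x hx) (hYd x hx)]
  simp only [Pi.sub_apply, map_sub, sub_apply, ContinuousLinearMap.flip_apply] at *
  -- The Ricci terms cancel; the factor `1 / 2` before the Lie derivative produces the `2` in `2 *
  -- (b - a)`.
  linarith

end GibbonsHawkingChart

/-! ### Uniqueness of soliton flows -/

/-- On a 4-manifold given by the Gibbons–Hawking construction over a connected real-analytic
Riemannian 3-manifold, two real-analytic soliton flows which agree along a local section of the
projection are equal. -/
theorem theorem3p1
    {N : Type*} [TopologicalSpace N] [T2Space N] [SecondCountableTopology N] [ConnectedSpace N]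
    [ChartedSpace E3 N] [IsManifold (𝓡 3) ω N]
    (h : Bundle.ContMDiffRiemannianMetric (𝓡 3) ω E3 (TangentSpace (𝓡 3) : N → Type _))
    (o : ∀ p : N, Orientation ℝ (TangentSpace (𝓡 3) p) (Fin 3)) (ho : IsOrientationField o)
    (u : N → ℝ) (A : ∀ p : N, TangentSpace (𝓡 3) p →L[ℝ] ℝ)
    (hGH : IsGibbonsHawkingData h o u A)
    (X Y : ∀ q : N × ℝ, TangentSpace ((𝓡 3).prod 𝓘(ℝ)) q)
    (hXan : IsAnalyticVectorField X) (hYan : IsAnalyticVectorField Y)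
    (hX : IsSolitonFlow ((𝓡 3).prod 𝓘(ℝ)) (gibbonsHawkingMetric h u A) X)
    (hY : IsSolitonFlow ((𝓡 3).prod 𝓘(ℝ)) (gibbonsHawkingMetric h u A) Y)
    (U : Set N) (σ : N → N × ℝ) (hσ : IsLocalSection U σ)
    (hXY : ∀ p ∈ U, X (σ p) = Y (σ p)) :
    X = Y := by
  obtain ⟨a, hX⟩ := hX
  obtain ⟨b, hY⟩ := hY
  obtain ⟨p₀, hp₀⟩ := hσ.nonempty
  obtain ⟨s, L, x₀, hs, hsx₀, hev⟩ := hσ.exists_graph hp₀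
  set p : N × ℝ := σ p₀
  set T := (extChartAt ((𝓡 3).prod 𝓘(ℝ)) p).target
  have hT : IsOpen T := isOpen_extChartAt_target p
  have hpT : extChartAt ((𝓡 3).prod 𝓘(ℝ)) p p ∈ T := mem_extChartAt_target p
  have hXa := analyticOnNhd_vectorFieldInChart hXan p
  have hYa := analyticOnNhd_vectorFieldInChart hYan p
  have hB := (contDiffOn_gibbonsHawkingInChart (h := h) hGH.contMDiff_fun hGH.pos hGH.contMDiff_form
    p).of_le (m := 2) (by norm_cast)
  have hhom := hX.isHomotheticOn_sub hY p
    (fun x hx => (hB.contDiffAt (hT.mem_nhds hx)).differentiableAt (by norm_num))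
    (fun x hx => (hXa x hx).differentiableAt) (fun x hx => (hYa x hx).differentiableAt)
  have hZa := hXa.sub hYa
  have hiff : ∀ x ∈ T, (vectorFieldInChart ((𝓡 3).prod 𝓘(ℝ)) X p -
      vectorFieldInChart ((𝓡 3).prod 𝓘(ℝ)) Y p) x = 0 ↔
      X ((extChartAt ((𝓡 3).prod 𝓘(ℝ)) p).symm x) = Y ((extChartAt ((𝓡 3).prod 𝓘(ℝ)) p).symm x) :=
    fun x hx => sub_eq_zero.trans (vectorFieldInChart_eq_iff p hx)
  generalize vectorFieldInChart ((𝓡 3).prod 𝓘(ℝ)) X p -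
    vectorFieldInChart ((𝓡 3).prod 𝓘(ℝ)) Y p = Z at *
  have hZs : ∀ᶠ x in 𝓝 x₀, Z (s x) = 0 := by
    filter_upwards [hev] with x ⟨_, hxT, q, hq, hxq⟩
    rw [hiff _ hxT, hxq]
    exact hXY q hq
  have hZp : Z (extChartAt ((𝓡 3).prod 𝓘(ℝ)) p p) = 0 := hsx₀ ▸ hZs.self_of_nhds
  have hL : ∀ v, (L v).1 = v := fun v => by
    have h1 : HasFDerivAt (fun x => (s x).1) (ContinuousLinearMap.id ℝ E3) x₀ :=
      (hasFDerivAt_id x₀).congr_of_eventuallyEq (hev.mono fun x hx => hx.1)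
    exact DFunLike.congr_fun (hs.fst.unique h1) v
  have hdZ : HasFDerivAt Z (fderiv ℝ Z (s x₀)) (s x₀) :=
    (hZa _ (hsx₀ ▸ hpT)).differentiableAt.hasFDerivAt
  -- Chain rule for `Z ∘ s`, which is zero near `x₀`: the derivative of `Z` kills the directions
  -- tangent to the section.
  have hKL : ∀ v, fderiv ℝ Z (s x₀) (L v) = 0 := fun v => by
    have h1 : HasFDerivAt (fun x => Z (s x)) (0 : E3 →L[ℝ] E3 × ℝ) x₀ :=
      (hasFDerivAt_const (0 : E3 × ℝ) x₀).congr_of_eventuallyEq hZs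
    exact DFunLike.congr_fun ((hdZ.comp x₀ hs).unique h1) v
  have hsymm : ∀ x ∈ T, ∀ v w, gibbonsHawkingInChart A h u p x v w
      = gibbonsHawkingInChart A h u p x w v := fun x _ v w => gibbonsHawkingMetric_symm A h u _ _ _
  have hpos : ∀ x ∈ T, ∀ v, v ≠ 0 → 0 < gibbonsHawkingInChart A h u p x v v :=
    fun x hx v hv => gibbonsHawkingInChart_pos hGH.pos p hx hv
  rw [hsx₀] at hKL
  obtain ⟨hc, hK⟩ := eq_zero_of_homothetic_of_comp_eq_zero (hpos _ hpT) (hsymm _ hpT)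
    (hhom.of_eq_zero hpT hZp) hL hKL
  rw [hc] at hhom
  have hZ0 := hhom.eventually_eq_zero hT hB (hZa.contDiffOn hT.uniqueDiffOn) hsymm hpos hpT hZp hK
  refine eq_of_eventuallyEq_of_analytic hXan hYan (p := p) ?_
  filter_upwards [(continuousAt_extChartAt (I := (𝓡 3).prod 𝓘(ℝ)) p).eventually hZ0,
    extChartAt_source_mem_nhds (I := (𝓡 3).prod 𝓘(ℝ)) p]
    with q hq hqs
  have := (hiff _ ((extChartAt ((𝓡 3).prod 𝓘(ℝ)) p).map_source hqs)).1 hq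
  rwa [(extChartAt ((𝓡 3).prod 𝓘(ℝ)) p).left_inv hqs] at this
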